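/- Let $p$ be a prime, $n$ a non-negative integer and $G\cong\mathbb Z_p^n$. A Cayley map $\mathcal M=\mathrm{Cay}(G,S,\rho)$ is given by a generating set $S=S^{-1}$ of $G$ with $1\notin S$ and a permutation $\rho$ of $S$ that is a single cycle on all of $S$: it is the embedding, in an orientable closed surface, of the Cayley graph with vertex set $G$ and arcs $(g,gs)$ ($g\in G$, $s\in S$) whose rotation at every vertex $g$ is $(g,gs)\mapsto(g,g\rho(s))$. Its automorphism group $\mathrm{Aut}(\mathcal M)$ consists of the automorphisms of the Cayley graph whose action on arcs commutes with the rotation; it contains the left regular representation of $G$, which we again denote by $G$. The map is regular if $\mathrm{Aut}(\mathcal M)$ acts regularly on the arcs. Let $\mathcal M$ be a regular Cayley map of $G\cong\mathbb Z_p^n$, and let the stabiliser in $\mathrm{Aut}(\mathcal M)$ of a vertex $v$ be $\langle\sigma\rangle$, of order $kp^m$ with $m\ge 0$ and $p\nmid k$. Then $$\mathrm{Aut}(\mathcal M)=(G\rtimes\langle\sigma^k\rangle)\rtimes\langle\sigma^{p^m}\rangle$$ as internal semidirect products. Moreover, $\mathrm{Aut}(\mathcal M)$ has a normal subgroup $T\cong\mathbb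 Z_p^n$ that is regular on the vertices, such that either $T=G$, or $n\ge 2$ and $T\cap G\cong\mathbb Z_p^{n-1}$. Consequently $\mathrm{Aut}(\mathcal M)=T\rtimes\langle\sigma\rangle\le\mathrm{AGL}(n,p)$; that is, there are a bijection from the vertex set $G$ to $\mathbb F_p^n$ taking $v$ to $0$ and an injective homomorphism $\mathrm{Aut}(\mathcal M)\to\mathrm{AGL}(n,p)$, compatible with the actions on $G$ and $\mathbb F_p^n$, which maps $T$ onto the group of translations. -/

import Mathlib

/-- A Cayley map `Cay(G, S, ρ)`: an inverse-closed generating set `S` of `G` not containing `1`,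
together with a cyclic permutation `ρ` of `S` (a single cycle running through all of `S`), which
prescribes the local orientation at every vertex. -/
structure CayleyMap (G : Type*) [Group G] where
  /-- the connection set -/
  S : Set G
  one_notMem : (1 : G) ∉ S
  inv_mem : ∀ s ∈ S, s⁻¹ ∈ S
  closure_eq_top : Subgroup.closure S = ⊤
  /-- the cyclic permutation of the connection set -/
  ρ : Equiv.Perm S
  ρ_cyclic : ∀ s t : S, ρ.SameCycle s t

namespace CayleyMap

variable {G : Type*} [Group G] (M : CayleyMap G)

/-- The underlying Cayley graph: vertices `G`, arcs `(g, g * s)` with `s ∈ S`. -/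
def graph : SimpleGraph G := SimpleGraph.mulCayley M.S

theorem graph_adj (g h : G) : M.graph.Adj g h ↔ g⁻¹ * h ∈ M.S := by
  rw [graph, SimpleGraph.mulCayley_adj']
  constructor
  · rintro ⟨-, s, hs, rfl | rfl⟩
    · simpa using hs
    · simpa using M.inv_mem s hs
  · intro hs
    refine ⟨?_, _, hs, Or.inl (by simp)⟩
    rintro rfl
    exact M.one_notMem (by simpa using hs)

/-- The label `s ∈ S` of the arc `(g, g * s)`. -/
def label (d : M.graph.Dart) : M.S := ⟨d.fst⁻¹ * d.snd, (M.graph_adj _ _).1 d.adj⟩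

/-- The rotation of the map: at each vertex `g` it sends the arc `(g, g * s)` to
`(g, g * ρ s)`. -/
def rotation (d : M.graph.Dart) : M.graph.Dart :=
  ⟨(d.fst, d.fst * (M.ρ (M.label d) : G)), by simp [graph_adj]⟩

/-- The group of orientation preserving automorphisms of the map: the automorphisms of the
underlying graph whose action on arcs commutes with the rotation. -/
def aut : Subgroup (M.graph ≃g M.graph) where
  carrier := {φ | ∀ d : M.graph.Dart,
    φ.toHom.mapDart (M.rotation d) = M.rotation (φ.toHom.mapDart d)}
  one_mem' := fun _ => rfl
  mul_mem' := by
    intro a b ha hb d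
    have h1 : (a * b).toHom.mapDart (M.rotation d)
        = a.toHom.mapDart (b.toHom.mapDart (M.rotation d)) := rfl
    rw [h1, hb d, ha]
    rfl
  inv_mem' := by
    intro a ha d
    have h2 : ∀ e : M.graph.Dart, a.toHom.mapDart ((a⁻¹).toHom.mapDart e) = e := by
      intro e
      apply SimpleGraph.Dart.ext
      exact Prod.ext (RelIso.apply_inv_self a _) (RelIso.apply_inv_self a _)
    have h3 : ∀ e : M.graph.Dart, (a⁻¹).toHom.mapDart (a.toHom.mapDart e) = e := by
      intro e
      apply SimpleGraph.Dart.ext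
      exact Prod.ext (RelIso.inv_apply_self a _) (RelIso.inv_apply_self a _)
    have h4 := ha ((a⁻¹).toHom.mapDart d)
    rw [h2] at h4
    rw [← h4, h3]

/-- The map is regular if its automorphism group acts regularly on arcs. -/
def IsRegular : Prop :=
  ∀ d e : M.graph.Dart, ∃! φ : M.aut, (φ : M.graph ≃g M.graph).toHom.mapDart d = e

/-- Left multiplication by `g`, as a map automorphism. -/
def leftMul (g : G) : M.aut :=
  ⟨{ toEquiv := Equiv.mulLeft g
     map_rel_iff' := by intro a b; simp [graph_adj, mul_assoc] }, by
    intro d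
    apply SimpleGraph.Dart.ext
    have hl : M.label (⟨(g * d.fst, g * d.snd), by
        have := d.adj
        simpa [graph_adj, mul_assoc] using this⟩ : M.graph.Dart) = M.label d := by
      apply Subtype.ext
      simp [label, mul_assoc]
    refine Prod.ext rfl ?_
    change g * (d.fst * (M.ρ (M.label d) : G)) = (g * d.fst) * (M.ρ (M.label _) : G)
    rw [← mul_assoc]
    exact congrArg (fun s : M.S => g * d.fst * (M.ρ s : G)) hl.symm⟩

/-- The left regular representation of `G` in the automorphism group of the map. -/
def leftRegular : G →* M.aut where
  toFun := M.leftMul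
  map_one' := by
    apply Subtype.ext
    apply RelIso.ext
    intro x
    exact one_mul x
  map_mul' := by
    intro a b
    apply Subtype.ext
    apply RelIso.ext
    intro x
    exact mul_assoc a b x

end CayleyMap

/-- `H = N ⋊ K` as an internal semidirect product of subgroups of `X`: `N` and `K` generate `H`,
they intersect trivially, and `N` is normal in `H`. -/
structure IsInternalSemidirect {X : Type*} [Group X] (N K H : Subgroup X) : Prop where
  sup_eq : N ⊔ K = H
  inf_eq : N ⊓ K = ⊥
  normal : (N.subgroupOf H).Normal

/-- A subgroup of a group acting on `Ω` is regular on `Ω`. -/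
def IsRegularOn {X : Type*} [Group X] (Ω : Type*) [MulAction X Ω] (T : Subgroup X) : Prop :=
  ∀ u v : Ω, ∃! t : T, t • u = v

/-- The elementary abelian group `ℤ_p ^ n`, written multiplicatively. -/
abbrev ElemAb (p n : ℕ) : Type := Multiplicative (Fin n → ZMod p)

/-- The affine group `AGL(n, p)`. -/
abbrev AGL (n p : ℕ) : Type := (Fin n → ZMod p) ≃ᵃ[ZMod p] (Fin n → ZMod p)

/-- The subgroup of translations of `AGL(n, p)`. -/
def AGL.translations (n p : ℕ) : Subgroup (AGL n p) :=
  (AffineEquiv.constVAddHom (ZMod p) (Fin n → ZMod p)).range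

/-! Write `A` for the automorphism group and `C = ⟨σ⟩`. Then `A = G * C` with `G`, `C` abelian and
`G ⊓ C = 1`; `C` is core-free because it is a point stabiliser of a faithful transitive action. By
Itô's theorem the commutator subgroup `A'` is abelian. A normal subgroup of order prime to `|G| = [A
: C]` lies in `C`, hence is trivial; so `A'` has no elements of order prime to `p` except `1`.
Consequently the elements of `p`-power order form a normal subgroup, which is `G * ⟨σ ^ k⟩`, and `⟨σ
^ p ^ m⟩` complements it.

For `p = 2` the group `G` itself is normal (`normal_of_two`), and `T = G`. A conjugate of `G`
leaving `G` would force the unique involution of `C` to centralise `G`, against core-freeness; the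
normaliser condition in a 2-group lets this argument reach all of `A`.

For odd `p` regularity enters: an involution `τ` reversing an arc generates `A` together with `σ`.
As `G` has odd exponent, its image in `A / A'` falls into that of `C`, so `A = A' * C`, and `T = A'`
is an abelian normal complement of `C`. If `T ≠ G`, then `G = (T ⊓ G) * ⟨y * z⟩` with `y ∈ T` and `z
∈ C` of order `p`. Here `T ⊓ G` is the centraliser of `z` in `T`, so it is normal in `A` and of
index `p` in `T`. Expanding `(y * z) ^ p = 1` gives `y ^ p = 1`, so `T` is elementary abelian
(`exists_normal_of_ne_two`).

Finally, points are identified with `T ≅ F_p ^ n`, on which `A` acts by affine maps with conjugation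
as linear part. -/

open scoped commutatorElement

/-! ### Itô's theorem on products of two abelian subgroups -/

section Ito

variable {A : Type*} [Group A]

theorem commutatorElement_mul_left_of_commute {x y z : A} (h : Commute y z) :
    ⁅x * y, z⁆ = ⁅x, z⁆ := by
  have h' : y * z * y⁻¹ = z := by rw [h.eq, mul_inv_cancel_right]
  calc ⁅x * y, z⁆ = x * (y * z * y⁻¹) * x⁻¹ * z⁻¹ := by
        simp only [commutatorElement_def, mul_inv_rev, mul_assoc]
    _ = ⁅x, z⁆ := by rw [h', commutatorElement_def]

theorem commutatorElement_mul_right_of_commute {x y z : A} (h : Commute x z) :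
    ⁅x, y * z⁆ = ⁅x, y⁆ := by
  rw [← commutatorElement_inv, commutatorElement_mul_left_of_commute h.symm,
    commutatorElement_inv]

variable {G C : Subgroup A}

theorem Subgroup.exists_mul_swap (h : ∀ x, ∃ g ∈ G, ∃ c ∈ C, g * c = x) (x : A) :
    ∃ c ∈ C, ∃ g ∈ G, c * g = x := by
  obtain ⟨g, hg, c, hc, e⟩ := h x⁻¹
  exact ⟨c⁻¹, C.inv_mem hc, g⁻¹, G.inv_mem hg, by rw [← mul_inv_rev, e, inv_inv]⟩

/-- In a product `G * C` of two abelian subgroups, the commutators `⁅a, b⁆` with `a ∈ G` and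
`b ∈ C` commute with each other. -/
theorem Subgroup.commute_commutatorElement (hG : ∀ x ∈ G, ∀ y ∈ G, Commute x y)
    (hC : ∀ x ∈ C, ∀ y ∈ C, Commute x y) (h : ∀ x, ∃ g ∈ G, ∃ c ∈ C, g * c = x)
    {a b a₁ b₁ : A} (ha : a ∈ G) (hb : b ∈ C) (ha₁ : a₁ ∈ G) (hb₁ : b₁ ∈ C) :
    Commute ⁅a₁, b₁⁆ ⁅a, b⁆ := by
  wlog hinv : ∃ a' ∈ G, ∃ b' ∈ C, a₁ = a'⁻¹ ∧ b₁ = b'⁻¹ generalizing a₁ b₁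
  · exact this ha₁ hb₁
      ⟨a₁⁻¹, G.inv_mem ha₁, b₁⁻¹, C.inv_mem hb₁, (inv_inv _).symm, (inv_inv _).symm⟩
  obtain ⟨x, hx, y, hy, rfl, rfl⟩ := hinv
  obtain ⟨a₃, ha₃, b₃, hb₃, e₃⟩ := h (y * a * y⁻¹)
  obtain ⟨b₂, hb₂, a₂, ha₂, e₂⟩ := exists_mul_swap h (x * b * x⁻¹)
  have hxa : x * a * x⁻¹ = a := by rw [(hG x hx a ha).eq, mul_inv_cancel_right]
  have hyb : y * b * y⁻¹ = b := by rw [(hC y hy b hb).eq, mul_inv_cancel_right]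
  have hxa₃ : x * a₃ * x⁻¹ = a₃ := by rw [(hG x hx _ ha₃).eq, mul_inv_cancel_right]
  have hyb₂ : y * b₂ * y⁻¹ = b₂ := by rw [(hC y hy _ hb₂).eq, mul_inv_cancel_right]
  -- Conjugating `⁅a, b⁆` by `x * y` and by `y * x` gives the same result, so `⁅x⁻¹, y⁻¹⁆` commutes
  -- with it.
  have h₁ : x * (y * ⁅a, b⁆ * y⁻¹) * x⁻¹ = ⁅a₃, b₂⁆ := by
    rw [conjugate_commutatorElement, hyb, ← e₃,
      commutatorElement_mul_left_of_commute (hC _ hb₃ _ hb), conjugate_commutatorElement, hxa₃,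
      ← e₂, commutatorElement_mul_right_of_commute (hG _ ha₃ _ ha₂)]
  have h₂ : y * (x * ⁅a, b⁆ * x⁻¹) * y⁻¹ = ⁅a₃, b₂⁆ := by
    rw [conjugate_commutatorElement, hxa, ← e₂,
      commutatorElement_mul_right_of_commute (hG _ ha _ ha₂), conjugate_commutatorElement, hyb₂,
      ← e₃, commutatorElement_mul_left_of_commute (hC _ hb₃ _ hb₂)]
  have h₃ := h₁.trans h₂.symm
  generalize ⁅a, b⁆ = w at h₃
  rw [commutatorElement_def]
  have h₄ : x * y * w * (x * y)⁻¹ = y * x * w * (y * x)⁻¹ := by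
    simpa only [mul_inv_rev, mul_assoc] using h₃
  have h₅ : x * y * w = y * x * w * (y * x)⁻¹ * (x * y) := by rw [← h₄]; group
  change x⁻¹ * y⁻¹ * x⁻¹⁻¹ * y⁻¹⁻¹ * w = w * (x⁻¹ * y⁻¹ * x⁻¹⁻¹ * y⁻¹⁻¹)
  calc x⁻¹ * y⁻¹ * x⁻¹⁻¹ * y⁻¹⁻¹ * w = (y * x)⁻¹ * (x * y * w) := by group
    _ = _ := by rw [h₅]; group

/-- Conjugation by `G` or by `C` only changes one entry of a commutator `⁅a, b⁆`, within its own
subgroup, so `⁅G, C⁆` is normal; modulo it the two abelian factors commute. -/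
theorem Subgroup.commutator_le_of_mul (hG : ∀ x ∈ G, ∀ y ∈ G, Commute x y)
    (hC : ∀ x ∈ C, ∀ y ∈ C, Commute x y) (h : ∀ x, ∃ g ∈ G, ∃ c ∈ C, g * c = x) :
    _root_.commutator A ≤ ⁅G, C⁆ := by
  have hn : (⁅G, C⁆).Normal := by
    have key : ∀ x : A, ∀ w ∈ ⁅G, C⁆, x * w * x⁻¹ ∈ ⁅G, C⁆ := by
      intro x w hw
      have hle : ⁅G, C⁆ ≤ (⁅G, C⁆).comap (MulAut.conj x).toMonoidHom := by
        rw [commutator_le]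
        intro a ha b hb
        change x * ⁅a, b⁆ * x⁻¹ ∈ ⁅G, C⁆
        have hx' : ∀ x ∈ G, ∀ a ∈ G, ∀ b ∈ C, x * ⁅a, b⁆ * x⁻¹ ∈ ⁅G, C⁆ := by
          intro x hx a ha b hb
          obtain ⟨b₂, hb₂, a₂, ha₂, e₂⟩ := exists_mul_swap h (x * b * x⁻¹)
          rw [conjugate_commutatorElement, (hG x hx a ha).eq, mul_inv_cancel_right, ← e₂,
            commutatorElement_mul_right_of_commute (hG _ ha _ ha₂)]
          exact commutator_mem_commutator ha hb₂
        obtain ⟨g, hg, c, hc, rfl⟩ := h x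
        obtain ⟨a₃, ha₃, b₃, hb₃, e₃⟩ := h (c * a * c⁻¹)
        have e : g * c * ⁅a, b⁆ * (g * c)⁻¹ = g * (c * ⁅a, b⁆ * c⁻¹) * g⁻¹ := by group
        rw [e, conjugate_commutatorElement (g₃ := c), (hC c hc b hb).eq, mul_inv_cancel_right, ← e₃,
          commutatorElement_mul_left_of_commute (hC _ hb₃ _ hb)]
        exact hx' g hg a₃ ha₃ b hb
      exact hle hw
    exact ⟨fun w hw x => key x w hw⟩
  rw [← Normal.quotient_commutative_iff_commutator_le]
  have hcomm : ∀ g ∈ G, ∀ c ∈ C, Commute (g : A ⧸ ⁅G, C⁆) (c : A ⧸ ⁅G, C⁆) := by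
    intro g hg c hc
    rw [← commutatorElement_eq_one_iff_commute]
    exact (QuotientGroup.eq_one_iff ⁅g, c⁆).2 (commutator_mem_commutator hg hc)
  have hmap : ∀ x y : A, Commute x y → Commute (x : A ⧸ ⁅G, C⁆) (y : A ⧸ ⁅G, C⁆) :=
    fun x y hxy => hxy.map (QuotientGroup.mk' ⁅G, C⁆)
  refine ⟨⟨fun x y => ?_⟩⟩
  obtain ⟨x, rfl⟩ := QuotientGroup.mk_surjective x
  obtain ⟨y, rfl⟩ := QuotientGroup.mk_surjective y
  obtain ⟨g, hg, c, hc, rfl⟩ := h x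
  obtain ⟨g', hg', c', hc', rfl⟩ := h y
  exact ((hmap _ _ (hG g hg g' hg')).mul_right (hcomm g hg c' hc')).mul_left
    ((hcomm g' hg' c hc).symm.mul_right (hmap _ _ (hC c hc c' hc')))

/-- Itô's theorem: a product of two abelian subgroups is metabelian. -/
theorem Subgroup.commute_of_mem_commutator (hG : ∀ x ∈ G, ∀ y ∈ G, Commute x y)
    (hC : ∀ x ∈ C, ∀ y ∈ C, Commute x y) (h : ∀ x, ∃ g ∈ G, ∃ c ∈ C, g * c = x)
    {x y : A} (hx : x ∈ _root_.commutator A) (hy : y ∈ _root_.commutator A) : Commute x y := by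
  have key : ⁅G, C⁆ ≤ centralizer (⁅G, C⁆ : Subgroup A) := by
    rw [commutator_le]
    intro a ha b hb
    rw [← zpowers_le, ← le_centralizer_iff, commutator_le]
    intro a' ha' b' hb'
    rw [mem_centralizer_iff]
    rintro _ ⟨i, rfl⟩
    exact (commute_commutatorElement hG hC h ha' hb' ha hb).zpow_left i
  have hle := commutator_le_of_mul hG hC h
  exact ((mem_centralizer_iff.1 (key (hle hy))) x (hle hx))

end Ito

/-! ### Factorizations with a core-free cyclic factor -/

section CyclicFactorization

variable {A : Type*} [Group A]

/-- A finite cyclic group has at most one subgroup of order `p`; here it is generated by `σ ^ N`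
with `N = orderOf σ / p`. -/
theorem mem_zpowers_of_pow_prime_eq_one [Finite A] {p : ℕ} (hp : p.Prime) {σ z w : A}
    (hz : z ∈ Subgroup.zpowers σ) (hw : w ∈ Subgroup.zpowers σ) (hzp : z ^ p = 1)
    (hwp : w ^ p = 1) (hz1 : z ≠ 1) : w ∈ Subgroup.zpowers z := by
  have : Fact p.Prime := ⟨hp⟩
  have hdvd : p ∣ orderOf σ := by
    rw [← orderOf_eq_prime hzp hz1]
    exact orderOf_dvd_of_mem_zpowers hz
  obtain ⟨N, hN⟩ := hdvd
  have hroot : ∀ y ∈ Subgroup.zpowers σ, y ^ p = 1 → y ∈ Subgroup.zpowers (σ ^ N) := by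
    rintro _ ⟨i, rfl⟩ hy
    simp only at hy ⊢
    rw [← zpow_natCast, ← zpow_mul, ← orderOf_dvd_iff_zpow_eq_one, hN] at hy
    push_cast at hy
    rw [mul_comm] at hy
    obtain ⟨j, rfl⟩ := Int.dvd_of_mul_dvd_mul_right (by exact_mod_cast hp.ne_zero) hy
    exact ⟨j, by simp [zpow_mul]⟩
  have hcard : Nat.card (Subgroup.zpowers (σ ^ N)) = p := by
    have hpos := orderOf_pos σ
    rw [Nat.card_zpowers, orderOf_pow, hN, Nat.gcd_eq_right (Nat.dvd_mul_left N p)]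
    refine Nat.mul_div_cancel _ (Nat.pos_of_ne_zero ?_)
    rintro rfl
    omega
  obtain ⟨i, hi⟩ := mem_zpowers_of_prime_card (p := p) hcard
    (g := ⟨z, hroot z hz hzp⟩) (g' := ⟨w, hroot w hw hwp⟩) (by simpa [Subtype.ext_iff] using hz1)
  exact ⟨i, by simpa [Subtype.ext_iff] using hi⟩

/-- `A = G * ⟨σ⟩` with `G` abelian of exponent dividing `p`, `G ⊓ ⟨σ⟩ = 1` and `⟨σ⟩`
core-free. -/
structure IsCyclicFactorization (p : ℕ) (G : Subgroup A) (σ : A) : Prop where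
  commute : ∀ x ∈ G, ∀ y ∈ G, Commute x y
  pow_eq_one : ∀ x ∈ G, x ^ p = 1
  exists_mul : ∀ x, ∃ g ∈ G, ∃ c ∈ Subgroup.zpowers σ, g * c = x
  eq_one : ∀ x ∈ G, x ∈ Subgroup.zpowers σ → x = 1
  core_eq_bot : ∀ R : Subgroup A, R.Normal → R ≤ Subgroup.zpowers σ → R = ⊥

theorem commute_of_mem_zpowers {σ x y : A} (hx : x ∈ Subgroup.zpowers σ)
    (hy : y ∈ Subgroup.zpowers σ) : Commute x y := by
  obtain ⟨i, rfl⟩ := hx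
  obtain ⟨j, rfl⟩ := hy
  exact Commute.zpow_zpow_self σ i j

namespace IsCyclicFactorization

variable {p : ℕ} {G : Subgroup A} {σ : A}

open Subgroup

/-- Such a `c` is central in `A = G * ⟨σ⟩`, so `⟨c⟩` is a normal subgroup inside the core-free
factor. -/
theorem eq_one_of_commute (h : IsCyclicFactorization p G σ) {c : A} (hc : c ∈ zpowers σ)
    (hG : ∀ g ∈ G, Commute c g) : c = 1 := by
  have hn : (zpowers c).Normal := by
    refine ⟨?_⟩
    rintro _ ⟨i, rfl⟩ x
    obtain ⟨g, hg, d, hd, rfl⟩ := h.exists_mul x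
    have hcomm : Commute (g * d) (c ^ i) :=
      ((hG g hg).symm.mul_left (commute_of_mem_zpowers hd hc)).zpow_right i
    exact ⟨i, by simp only; rw [hcomm.eq, mul_inv_cancel_right]⟩
  have := h.core_eq_bot _ hn (by rwa [zpowers_le])
  rwa [zpowers_eq_bot] at this

theorem isComplement (h : IsCyclicFactorization p G σ) : G.IsComplement' (zpowers σ) := by
  refine isComplement'_of_disjoint_and_mul_eq_univ ?_ ?_
  · rw [disjoint_def]
    exact fun hx hy => h.eq_one _ hx hy
  · refine Set.eq_univ_of_forall fun x => ?_
    obtain ⟨g, hg, c, hc, rfl⟩ := h.exists_mul x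
    exact Set.mul_mem_mul hg hc

/-- The index of `R ⊓ ⟨σ⟩` in `R` divides both `|R|` and `[A : ⟨σ⟩] = |G|`, so it is `1` and `R`
lies in the core-free factor. -/
theorem normal_eq_bot_of_coprime [Finite A] (h : IsCyclicFactorization p G σ) (R : Subgroup A) [R.Normal]
    (hR : (Nat.card R).Coprime (Nat.card G)) : R = ⊥ := by
  have h₁ : (zpowers σ).relIndex R ∣ Nat.card R := relIndex_dvd_card _ _
  have h₂ : (zpowers σ).relIndex R ∣ Nat.card G := by
    rw [← h.isComplement.index_eq_card]
    have : (zpowers σ).relIndex (zpowers σ ⊔ R) = (zpowers σ).relIndex R := by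
      have h₄ := relIndex_mul_relIndex (zpowers σ ⊓ R) (zpowers σ) (zpowers σ ⊔ R) inf_le_left
        le_sup_left
      rw [← relIndex_mul_relIndex (zpowers σ ⊓ R) R (zpowers σ ⊔ R) inf_le_right le_sup_right,
        inf_relIndex_left, inf_relIndex_right, relIndex_sup_right, mul_comm] at h₄
      exact Nat.eq_of_mul_eq_mul_right 
        (Nat.pos_of_dvd_of_pos (relIndex_dvd_card _ _) Nat.card_pos) h₄
    rw [← this]
    exact relIndex_dvd_index_of_le le_sup_left
  have h₃ := Nat.eq_one_of_dvd_coprimes hR h₁ h₂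
  exact h.core_eq_bot R inferInstance (relIndex_eq_one.1 h₃)

theorem commute_of_mem_commutator (h : IsCyclicFactorization p G σ) {x y : A}
    (hx : x ∈ _root_.commutator A) (hy : y ∈ _root_.commutator A) : Commute x y :=
  Subgroup.commute_of_mem_commutator h.commute (fun _ hx _ hy => commute_of_mem_zpowers hx hy)
    h.exists_mul hx hy

theorem eq_one_of_mem_commutator [Finite A] (h : IsCyclicFactorization p G σ) (hp : p.Prime)
    {n k : ℕ} (hcard : Nat.card G = p ^ n) (hk : ¬ p ∣ k) {x : A}
    (hx : x ∈ _root_.commutator A) (hxk : x ^ k = 1) : x = 1 := by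
  have : Fact p.Prime := ⟨hp⟩
  -- The `k`-torsion of `A'` is a subgroup by Itô's theorem; by Cauchy its order is prime to `p`.
  let R : Subgroup A :=
    { carrier := {x | x ∈ _root_.commutator A ∧ x ^ k = 1}
      one_mem' := ⟨one_mem _, one_pow _⟩
      mul_mem' := fun {a b} ha hb => ⟨mul_mem ha.1 hb.1, by
        rw [(h.commute_of_mem_commutator ha.1 hb.1).mul_pow, ha.2, hb.2, one_mul]⟩
      inv_mem' := fun {a} ha => ⟨inv_mem ha.1, by rw [inv_pow, ha.2, inv_one]⟩ }
  have hR : R.Normal := ⟨fun a ha g =>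
    ⟨Normal.conj_mem inferInstance a ha.1 g, by rw [conj_pow, ha.2, mul_one, mul_inv_cancel]⟩⟩
  have hbot : R = ⊥ := by
    refine h.normal_eq_bot_of_coprime R ?_
    rw [hcard]
    refine Nat.Coprime.pow_right _ (Nat.Coprime.symm ((hp.coprime_iff_not_dvd).2 fun hdvd => ?_))
    obtain ⟨y, hy⟩ := exists_prime_orderOf_dvd_card' p hdvd
    refine hk (hy ▸ orderOf_dvd_of_pow_eq_one ?_)
    exact Subtype.ext y.2.2
  have : x ∈ R := ⟨hx, hxk⟩
  rwa [hbot, mem_bot] at this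

theorem card_eq [Finite A] (h : IsCyclicFactorization p G σ) :
    Nat.card A = Nat.card G * orderOf σ := by
  rw [← h.isComplement.card_mul_card, Nat.card_zpowers]

/-- The elements of `p`-power order form the normal subgroup `G * ⟨σ ^ k⟩`. -/
theorem mem_sup_zpowers_iff [Finite A] (h : IsCyclicFactorization p G σ) (hp : p.Prime)
    {n k m : ℕ} (hcard : Nat.card G = p ^ n) (hk : ¬ p ∣ k) (hσ : orderOf σ = k * p ^ m)
    (x : A) : x ∈ G ⊔ zpowers (σ ^ k) ↔ x ^ p ^ (n + m) = 1 := by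
  -- Taking `p ^ (n + m)`-th powers is a homomorphism only modulo `A'`. A power landing in `A'` is
  -- killed by `k`, since `|A| = p ^ (n + m) * k`, hence is already `1`.
  let P : Subgroup A := ((powMonoidHom (p ^ (n + m))).comp (Abelianization.of (G := A))).ker
  have hP : ∀ x, x ∈ P ↔ x ^ p ^ (n + m) = 1 := by
    intro x
    have h₁ : x ∈ P ↔ x ^ p ^ (n + m) ∈ _root_.commutator A := by
      rw [← Abelianization.ker_of, MonoidHom.mem_ker, MonoidHom.mem_ker]
      simp
    rw [h₁]
    refine ⟨fun hx => h.eq_one_of_mem_commutator hp hcard hk hx ?_, fun hx => hx ▸ one_mem _⟩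
    rw [← pow_mul, show p ^ (n + m) * k = Nat.card A by rw [h.card_eq, hcard, hσ]; ring,
      pow_card_eq_one']
  rw [← hP]
  have hG : G ≤ P := fun g hg => by
    rcases Nat.eq_zero_or_pos n with rfl | hn
    · have : g = 1 := by
        have := (card_le_one_iff_eq_bot G).1 (by simp [hcard])
        rwa [this, mem_bot] at hg
      rw [this]
      exact one_mem _
    · rw [hP, show p ^ (n + m) = p * p ^ (n + m - 1) by rw [← pow_succ']; congr 1; omega, pow_mul,
        h.pow_eq_one g hg, one_pow]
  have ha : σ ^ k ∈ P := by
    rw [hP, ← pow_mul, show k * p ^ (n + m) = orderOf σ * p ^ n by rw [hσ]; ring, pow_mul,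
      pow_orderOf_eq_one, one_pow]
  constructor
  · intro hx
    exact (sup_le hG (by rwa [zpowers_le])) hx
  · intro hx
    obtain ⟨g, hg, c, hc, rfl⟩ := h.exists_mul x
    refine mul_mem (mem_sup_left hg) (mem_sup_right ?_)
    have hcP : c ∈ P := (mul_mem_cancel_left (hG hg)).1 hx
    obtain ⟨i, rfl⟩ := hc
    simp only at hcP ⊢
    rw [hP, ← zpow_natCast, ← zpow_mul, ← orderOf_dvd_iff_zpow_eq_one, hσ] at hcP
    have hki : (k : ℤ) ∣ i := by
      refine IsCoprime.dvd_of_dvd_mul_right (z := ((p ^ (n + m) : ℕ) : ℤ)) ?_ (dvd_trans ?_ hcP)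
      · rw [Nat.isCoprime_iff_coprime]
        exact Nat.Coprime.pow_right _ ((hp.coprime_iff_not_dvd).2 hk).symm
      · push_cast; exact dvd_mul_right _ _
    obtain ⟨j, rfl⟩ := hki
    exact ⟨j, by simp [zpow_mul]⟩

theorem isInternalSemidirect_top [Finite A] (h : IsCyclicFactorization p G σ) (hp : p.Prime)
    {n k m : ℕ} (hcard : Nat.card G = p ^ n) (hk : ¬ p ∣ k) (hσ : orderOf σ = k * p ^ m) :
    IsInternalSemidirect (G ⊔ zpowers (σ ^ k)) (zpowers (σ ^ p ^ m)) ⊤ := by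
  have hmem := h.mem_sup_zpowers_iff hp hcard hk hσ
  have hcop : ∀ i, (k).Coprime (p ^ i) := fun i =>
    Nat.Coprime.pow_right _ ((hp.coprime_iff_not_dvd).2 hk).symm
  constructor
  · have hσmem : σ ∈ (G ⊔ zpowers (σ ^ k)) ⊔ zpowers (σ ^ p ^ m) := by
      have hb := Nat.isCoprime_iff_coprime.2 (hcop m)
      obtain ⟨u, v, huv⟩ := hb
      have : σ = (σ ^ k) ^ u * (σ ^ p ^ m) ^ v := by
        rw [← zpow_natCast, ← zpow_natCast, ← zpow_mul, ← zpow_mul, ← zpow_add, mul_comm (k : ℤ),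
          mul_comm ((p ^ m : ℕ) : ℤ), huv, zpow_one]
      have hmul : (σ ^ k) ^ u * (σ ^ p ^ m) ^ v ∈ (G ⊔ zpowers (σ ^ k)) ⊔ zpowers (σ ^ p ^ m) :=
        mul_mem (mem_sup_left (mem_sup_right ⟨u, rfl⟩)) (mem_sup_right ⟨v, rfl⟩)
      rwa [← this] at hmul
    rw [eq_top_iff]
    intro x _
    obtain ⟨g, hg, c, hc, rfl⟩ := h.exists_mul x
    exact mul_mem (mem_sup_left (mem_sup_left hg)) ((zpowers_le.2 hσmem) hc)
  · rw [eq_bot_iff]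
    intro x hx
    rw [mem_inf, hmem] at hx
    obtain ⟨hx, i, rfl⟩ := hx
    simp only at hx ⊢
    have h₁ : orderOf ((σ ^ p ^ m) ^ i) ∣ p ^ (n + m) := orderOf_dvd_of_pow_eq_one hx
    have h₂ : orderOf ((σ ^ p ^ m) ^ i) ∣ k := by
      refine orderOf_dvd_of_pow_eq_one ?_
      rw [← zpow_natCast, ← zpow_mul, mul_comm, zpow_mul, zpow_natCast, ← pow_mul, mul_comm,
        ← hσ, pow_orderOf_eq_one, one_zpow]
    rw [mem_bot, ← orderOf_eq_one_iff]
    exact Nat.eq_one_of_dvd_coprimes (hcop _) h₂ h₁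
  · refine ⟨fun x hx g => ?_⟩
    rw [mem_subgroupOf, hmem] at hx ⊢
    rw [coe_mul, coe_mul, coe_inv, conj_pow, hx, mul_one, mul_inv_cancel]

/-! ### The case `p = 2` -/

theorem exists_involution_mul (h : IsCyclicFactorization 2 G σ) {H : Subgroup A} (hGH : G ≤ H)
    (hHG : ∀ x ∈ H, ∀ g ∈ G, x * g * x⁻¹ ∈ G) {c : A} (hcH : c ∈ normalizer (H : Set A))
    {g : A} (hg : g ∈ G) : ∃ z ∈ zpowers σ, z ^ 2 = 1 ∧ c * g * c⁻¹ * z ∈ G := by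
  have hyH : c * g * c⁻¹ ∈ H := (mem_normalizer_iff.1 hcH g).1 (hGH hg)
  have hy2 : (c * g * c⁻¹) ^ 2 = 1 := by rw [conj_pow, h.pow_eq_one g hg, mul_one, mul_inv_cancel]
  obtain ⟨x, hx, z, hz, e⟩ := h.exists_mul (c * g * c⁻¹)
  have hzH : z ∈ H := by
    rw [← e] at hyH
    exact (mul_mem_cancel_left (hGH hx)).1 hyH
  -- As `(x * z) ^ 2 = 1` and `z ∈ H` normalises `G`, the square `z ^ 2` lies in `G ⊓ ⟨σ⟩`.
  have hz2 : z ^ 2 = 1 := by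
    refine h.eq_one _ ?_ (pow_mem hz 2)
    have : z ^ 2 = (z * x * z⁻¹)⁻¹ * x⁻¹ * (x * z) ^ 2 := by simp only [pow_two]; group
    rw [this, e, hy2, mul_one]
    exact mul_mem (inv_mem (hHG z hzH x hx)) (inv_mem hx)
  refine ⟨z, hz, hz2, ?_⟩
  rwa [← e, mul_assoc, ← pow_two, hz2, mul_one]

/-- If `c * g * c⁻¹ ∉ G`, its `⟨σ⟩`-component is an involution `z`. Each `x ∈ G` commutes with `z`:
if `c⁻¹ * x * c ∈ G`, because it commutes with `g`; otherwise its `⟨σ⟩`-component is again `z`, the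
only involution of `⟨σ⟩`, and `(x * z) ^ 2 = 1`. -/
theorem conj_mem_of_mem_normalizer [Finite A] (h : IsCyclicFactorization 2 G σ)
    {H : Subgroup A} (hGH : G ≤ H) (hHG : ∀ x ∈ H, ∀ g ∈ G, x * g * x⁻¹ ∈ G) {c : A}
    (hc : c ∈ zpowers σ) (hcH : c ∈ normalizer (H : Set A)) {g : A} (hg : g ∈ G) :
    c * g * c⁻¹ ∈ G := by
  obtain ⟨z, hz, hz2, hzG⟩ := h.exists_involution_mul hGH hHG hcH hg
  by_cases hz1 : z = 1
  · rwa [hz1, mul_one] at hzG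
  refine absurd (h.eq_one_of_commute hz fun x hx => ?_) hz1
  obtain ⟨w, hw, hw2, hwG⟩ := h.exists_involution_mul hGH hHG (inv_mem hcH) hx
  rw [inv_inv] at hwG
  by_cases hw1 : w = 1
  · rw [hw1, mul_one] at hwG
    have h₁ : Commute (c * g * c⁻¹) x := by
      have := (h.commute _ hg _ hwG).map (MulAut.conj c).toMonoidHom
      simpa [mul_assoc] using this
    have h₂ := h₁.inv_left.mul_left (h.commute _ hzG _ hx)
    rwa [inv_mul_cancel_left] at h₂
  · have hwz : w = z := by
      obtain ⟨i, rfl⟩ := mem_zpowers_of_pow_prime_eq_one Nat.prime_two hz hw hz2 hw2 hz1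
      rcases Int.even_or_odd' i with ⟨j, rfl | rfl⟩
      · simp only [zpow_mul] at hw1
        exact absurd (by rw [zpow_ofNat, hz2, one_zpow]) hw1
      · simp only
        rw [zpow_add, zpow_mul, zpow_ofNat, hz2, one_zpow, one_mul, zpow_one]
    subst hwz
    have hxw : (x * w) ^ 2 = 1 := by
      have h₁ := h.pow_eq_one _ hwG
      have hcw := commute_of_mem_zpowers hc hw
      have e : c⁻¹ * x * c * w = c⁻¹ * (x * w) * c⁻¹⁻¹ := by
        rw [inv_inv, mul_assoc, hcw.eq]; group
      rw [e, conj_pow] at h₁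
      exact conj_eq_one_iff.1 h₁
    have hx2 := h.pow_eq_one x hx
    have hxi : x⁻¹ = x := by rw [inv_eq_iff_mul_eq_one, ← pow_two, hx2]
    have hwi : w⁻¹ = w := by rw [inv_eq_iff_mul_eq_one, ← pow_two, hw2]
    have : x * w = (x * w)⁻¹ := by rw [eq_inv_iff_mul_eq_one, ← pow_two, hxw]
    rw [mul_inv_rev, hxi, hwi] at this
    exact this.symm

theorem normal_of_two [Finite A] (h : IsCyclicFactorization 2 G σ)
    {n k m : ℕ} (hcard : Nat.card G = 2 ^ n) (hk : ¬ 2 ∣ k) (hσ : orderOf σ = k * 2 ^ m) :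
    G.Normal := by
  have hmem := h.mem_sup_zpowers_iff Nat.prime_two hcard hk hσ
  set P := G ⊔ zpowers (σ ^ k)
  have hGP : G ≤ P := le_sup_left
  have hPn : P.Normal := ⟨fun x hx g => by
    rw [hmem] at hx ⊢
    rw [conj_pow, hx, mul_one, mul_inv_cancel]⟩
  have hPp : IsPGroup 2 P := fun x => ⟨n + m, Subtype.ext ((hmem x).1 x.2)⟩
  have hfact : Fact (Nat.Prime 2) := ⟨Nat.prime_two⟩
  have hnil := hPp.isNilpotent
  have hPN : ∀ x ∈ P, ∀ g ∈ G, x * g * x⁻¹ ∈ G := by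
    -- Otherwise some `x ∈ P` outside the normaliser of `G` normalises `H = normalizer G ⊓ P`. Its
    -- `⟨σ⟩`-component then normalises `H` too, hence `G` by the previous lemma, a contradiction.
    have htop : (normalizer (G : Set A)).subgroupOf P = ⊤ := by
      by_contra hne
      obtain ⟨x, hx, hxn⟩ := SetLike.exists_of_lt
        (Group.normalizerCondition_of_isNilpotent _ (lt_top_iff_ne_top.2 hne))
      refine hxn ?_
      obtain ⟨g, hg, c, hc, e⟩ := h.exists_mul (x : A)
      have hgN : g ∈ normalizer (G : Set A) := le_normalizer hg
      have hxH : (x : A) ∈ normalizer ((normalizer (G : Set A) ⊓ P : Subgroup A) : Set A) := by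
        rw [mem_normalizer_iff] at hx ⊢
        intro y
        have hyP : x * y * (x : A)⁻¹ ∈ P ↔ y ∈ P :=
            ⟨fun hy => by simpa [mul_assoc] using hPn.conj_mem _ hy (x : A)⁻¹,
              fun hy => hPn.conj_mem _ hy _⟩
        constructor
        · rintro ⟨hy₁, hy₂⟩
          exact ⟨(hx ⟨y, hy₂⟩).1 hy₁, hyP.2 hy₂⟩
        · rintro ⟨hy₁, hy₂⟩
          exact ⟨(hx ⟨y, hyP.1 hy₂⟩).2 hy₁, hyP.1 hy₂⟩
      have hcH : c ∈ normalizer ((normalizer (G : Set A) ⊓ P : Subgroup A) : Set A) := by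
        have : c = g⁻¹ * x := by rw [← e, inv_mul_cancel_left]
        rw [this]
        exact mul_mem (inv_mem (le_normalizer ⟨hgN, hGP hg⟩)) hxH
      have hGN : ∀ y ∈ normalizer (G : Set A) ⊓ P, ∀ g ∈ G, y * g * y⁻¹ ∈ G :=
        fun y hy g hg => (mem_normalizer_iff.1 hy.1 g).1 hg
      have hle : G ≤ normalizer (G : Set A) ⊓ P := le_inf le_normalizer hGP
      rw [mem_subgroupOf, ← e]
      refine mul_mem hgN (mem_normalizer_iff.2 fun y => ⟨fun hy =>
        h.conj_mem_of_mem_normalizer hle hGN hc hcH hy, fun hy => ?_⟩)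
      have := h.conj_mem_of_mem_normalizer hle hGN (inv_mem hc) (inv_mem hcH) hy
      simpa [mul_assoc] using this
    intro x hx g hg
    have : x ∈ normalizer (G : Set A) := subgroupOf_eq_top.1 htop hx
    exact (mem_normalizer_iff.1 this g).1 hg
  refine ⟨fun g hg x => ?_⟩
  obtain ⟨y, hy, c, hc, rfl⟩ := h.exists_mul x
  have hcP : c ∈ normalizer (P : Set A) := by rw [normalizer_eq_top]; exact mem_top c
  have := h.conj_mem_of_mem_normalizer hGP hPN hc hcP hg
  have e : y * c * g * (y * c)⁻¹ = y * (c * g * c⁻¹) * y⁻¹ := by group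
  rw [e]
  exact mul_mem (mul_mem hy this) (inv_mem hy)

end IsCyclicFactorization

end CyclicFactorization

/-! ### The case of odd `p` -/

section OddPrime

variable {A : Type*} [Group A]

/-- The power formula of nilpotency class two: moving each `z` past the later factors `n` costs `0 +
1 + ⋯ + (i - 1)` copies of `ζ`. -/
theorem mul_pow_of_mul_eq {n z ζ : A} (hn : Commute ζ n) (hz : Commute ζ z)
    (h : z * n = ζ * n * z) (i : ℕ) : (n * z) ^ i = ζ ^ i.choose 2 * n ^ i * z ^ i := by
  have hzi : ∀ i : ℕ, z ^ i * n = ζ ^ i * n * z ^ i := by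
    intro i
    induction i with
    | zero => simp
    | succ i ih =>
      calc z ^ (i + 1) * n = z * (z ^ i * n) := by rw [pow_succ', mul_assoc]
        _ = (z * ζ ^ i) * n * z ^ i := by rw [ih]; simp only [mul_assoc]
        _ = ζ ^ i * (z * n) * z ^ i := by rw [← (hz.pow_left i).eq]; simp only [mul_assoc]
        _ = ζ ^ (i + 1) * n * z ^ (i + 1) := by
          rw [h, pow_succ ζ, pow_succ' z]; simp only [mul_assoc]
  induction i with
  | zero => simp
  | succ i ih =>
    calc (n * z) ^ (i + 1) = ζ ^ i.choose 2 * n ^ i * (z ^ i * n) * z := by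
          rw [pow_succ, ih]; simp only [mul_assoc]
      _ = ζ ^ i.choose 2 * (n ^ i * ζ ^ i) * n * (z ^ i * z) := by
          rw [hzi]; simp only [mul_assoc]
      _ = ζ ^ i.choose 2 * (ζ ^ i * n ^ i) * n * (z ^ i * z) := by
          rw [(hn.pow_pow i i).eq]
      _ = ζ ^ (i + 1).choose 2 * n ^ (i + 1) * z ^ (i + 1) := by
          rw [Nat.choose_succ_succ' i 1, Nat.choose_one_right, add_comm, pow_add, pow_succ n,
            pow_succ z]
          simp only [mul_assoc]

/-- If `x` acts on `⟨y⟩` by `y ↦ y ^ j`, then `j ^ p ^ r ≡ 1` modulo `p`, and Fermat gives `j ≡ 1`.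
-/
theorem commute_of_conj_mem_zpowers {p r : ℕ} (hp : p.Prime) {x y : A} (hy : y ^ p = 1)
    (hx : x ^ p ^ r = 1) (h : x * y * x⁻¹ ∈ Subgroup.zpowers y) : Commute x y := by
  have : Fact p.Prime := ⟨hp⟩
  by_cases hy1 : y = 1
  · rw [hy1]; exact Commute.one_right x
  obtain ⟨j, hj⟩ := h
  simp only at hj
  have hi : ∀ i : ℕ, x ^ i * y * (x ^ i)⁻¹ = y ^ j ^ i := by
    intro i
    induction i with
    | zero => simp
    | succ i ih =>
      calc x ^ (i + 1) * y * (x ^ (i + 1))⁻¹ = x * (x ^ i * y * (x ^ i)⁻¹) * x⁻¹ := by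
            rw [pow_succ']; group
        _ = y ^ j ^ (i + 1) := by rw [ih, ← conj_zpow, ← hj, ← zpow_mul, pow_succ']
  have h₁ := hi (p ^ r)
  rw [hx, one_mul, inv_one, mul_one] at h₁
  have horder := orderOf_eq_prime hy hy1
  have h₂ : ((p : ℤ)) ∣ j ^ p ^ r - 1 := by
    rw [← horder, orderOf_dvd_iff_zpow_eq_one, horder, zpow_sub, ← h₁, zpow_one, mul_inv_cancel]
  have h₃ : ((p : ℤ)) ∣ j - 1 := by
    rw [← ZMod.intCast_zmod_eq_zero_iff_dvd] at h₂ ⊢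
    push_cast at h₂ ⊢
    rwa [ZMod.pow_card_pow] at h₂
  have h₄ : y ^ j = y := by
    rw [← horder, orderOf_dvd_iff_zpow_eq_one, zpow_sub, zpow_one, mul_inv_eq_one] at h₃
    exact h₃
  rw [h₄] at hj
  exact (mul_inv_eq_iff_eq_mul.1 hj.symm)

namespace IsCyclicFactorization

variable {p : ℕ} {G : Subgroup A} {σ : A}

open Subgroup

/-- Modulo `A'` the image `D` of `⟨σ⟩` contains all squares, as `τ ^ 2 = 1`; elements of `G` have
odd exponent `p`, so their images are squares. -/
theorem exists_commutator_mul (h : IsCyclicFactorization p G σ) (hp : p.Prime) (hp2 : p ≠ 2)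
    {τ : A} (hτ : τ ^ 2 = 1) (hgen : zpowers σ ⊔ zpowers τ = ⊤) (x : A) :
    ∃ y ∈ _root_.commutator A, ∃ c ∈ zpowers σ, y * c = x := by
  let f := Abelianization.of (G := A)
  let D := (zpowers σ).map f
  have hsq : ∀ x : A, f x ^ 2 ∈ D := by
    have : (D.comap (powMonoidHom 2)).comap f = ⊤ := by
      rw [eq_top_iff, ← hgen, sup_le_iff, zpowers_le, zpowers_le]
      refine ⟨pow_mem (mem_map_of_mem f (mem_zpowers σ)) 2, ?_⟩
      change f τ ^ 2 ∈ D
      rw [← map_pow, hτ, map_one]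
      exact one_mem D
    intro x
    have hx : x ∈ (D.comap (powMonoidHom 2)).comap f := this ▸ mem_top x
    exact hx
  have hfx : f x ∈ D := by
    obtain ⟨g, hg, c, hc, rfl⟩ := h.exists_mul x
    rw [map_mul]
    refine mul_mem ?_ (mem_map_of_mem f hc)
    obtain ⟨j, hj⟩ := hp.odd_of_ne_two hp2
    have h₁ : f g ^ p = 1 := by rw [← map_pow, h.pow_eq_one g hg, map_one]
    rw [hj, pow_succ, pow_mul] at h₁
    rw [← inv_eq_of_mul_eq_one_right h₁]
    exact inv_mem (pow_mem (hsq g) j)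
  obtain ⟨c, hc, e⟩ := hfx
  refine ⟨x * c⁻¹, ?_, c, hc, inv_mul_cancel_right x c⟩
  rw [← Abelianization.ker_of, MonoidHom.mem_ker, map_mul, map_inv]
  exact mul_inv_eq_one.2 e.symm

/-- Such an element commutes with `A'` by Itô and with `⟨σ⟩`, so it is central. -/
theorem eq_one_of_mem_commutator_of_mem_zpowers (h : IsCyclicFactorization p G σ)
    (hN : ∀ x, ∃ y ∈ _root_.commutator A, ∃ c ∈ zpowers σ, y * c = x) {x : A}
    (hx : x ∈ _root_.commutator A) (hxC : x ∈ zpowers σ) : x = 1 := by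
  refine h.eq_one_of_commute hxC fun g _ => ?_
  obtain ⟨y, hy, c, hc, rfl⟩ := hN g
  exact (h.commute_of_mem_commutator hx hy).mul_right (commute_of_mem_zpowers hxC hc)

theorem card_commutator [Finite A] (h : IsCyclicFactorization p G σ)
    (hN : ∀ x, ∃ y ∈ _root_.commutator A, ∃ c ∈ zpowers σ, y * c = x) :
    Nat.card (_root_.commutator A) = Nat.card G := by
  have hc : (_root_.commutator A).IsComplement' (zpowers σ) := by
    refine isComplement'_of_disjoint_and_mul_eq_univ ?_ ?_
    · rw [disjoint_def]
      exact fun hx hy => h.eq_one_of_mem_commutator_of_mem_zpowers hN hx hy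
    · refine Set.eq_univ_of_forall fun x => ?_
      obtain ⟨g, hg, c, hc, rfl⟩ := hN x
      exact Set.mul_mem_mul hg hc
  rw [← hc.index_eq_card, h.isComplement.index_eq_card]

/-- If `G` is not the commutator subgroup `N`, then `G = (N ⊓ G) * ⟨y * z⟩` with `y ∈ N` and
`z ∈ ⟨σ⟩` of order `p`. -/
theorem exists_generator [Finite A] (h : IsCyclicFactorization p G σ) (hp : p.Prime)
    (hN : ∀ x, ∃ y ∈ _root_.commutator A, ∃ c ∈ zpowers σ, y * c = x)
    (hne : _root_.commutator A ≠ G) :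
    ∃ y ∈ _root_.commutator A, ∃ z ∈ zpowers σ, y * z ∈ G ∧ z ≠ 1 ∧ z ^ p = 1 ∧
      (∀ g ∈ G, ∃ i : ℤ, g * ((y * z) ^ i)⁻¹ ∈ _root_.commutator A) ∧
      Nat.card (_root_.commutator A ⊓ G : Subgroup A) * p = Nat.card G := by
  have : Fact p.Prime := ⟨hp⟩
  let f := Abelianization.of (G := A)
  have hker : ∀ x, f x = 1 ↔ x ∈ _root_.commutator A := fun x => by
    rw [← Abelianization.ker_of, MonoidHom.mem_ker]
  have hfy : ∀ y ∈ _root_.commutator A, ∀ c, f (y * c) = f c := fun y hy c => by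
    rw [map_mul, (hker y).2 hy, one_mul]
  have hpow : ∀ y ∈ _root_.commutator A, ∀ c ∈ zpowers σ, y * c ∈ G → c ^ p = 1 := by
    intro y hy c hc hG
    refine h.eq_one_of_mem_commutator_of_mem_zpowers hN ?_ (pow_mem hc p)
    rw [← hker, map_pow, ← hfy y hy, ← map_pow, h.pow_eq_one _ hG, map_one]
  have hnle : ¬ G ≤ _root_.commutator A := fun hle =>
    hne (eq_of_le_of_card_ge hle (h.card_commutator hN).le).symm
  obtain ⟨g, hg, hgN⟩ := SetLike.not_le_iff_exists.1 hnle
  obtain ⟨y, hy, z, hz, rfl⟩ := hN g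
  have hz1 : z ≠ 1 := by
    rintro rfl
    exact hgN (by rwa [mul_one])
  have hzp := hpow y hy z hz hg
  -- The `⟨σ⟩`-components of elements of `G` are killed by `p`, so they all lie in `⟨z⟩`, and `G`
  -- has image of order `p` in `A / A'`.
  have hgen : ∀ g ∈ G, ∃ i : ℤ, f g = f z ^ i := by
    intro g hg
    obtain ⟨y', hy', c, hc, rfl⟩ := hN g
    obtain ⟨i, rfl⟩ := mem_zpowers_of_pow_prime_eq_one hp hz hc hzp (hpow y' hy' c hc hg) hz1
    exact ⟨i, by rw [hfy y' hy', map_zpow]⟩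
  refine ⟨y, hy, z, hz, hg, hz1, hzp, fun g hg => ?_, ?_⟩
  · obtain ⟨i, hi⟩ := hgen g hg
    exact ⟨i, by rw [← hker, map_mul, map_inv, map_zpow, hfy y hy, hi, mul_inv_cancel]⟩
  · have hmap : G.map f = zpowers (f z) := by
      refine le_antisymm ?_ ?_
      · rintro _ ⟨g, hg, rfl⟩
        obtain ⟨i, hi⟩ := hgen g hg
        exact ⟨i, hi.symm⟩
      · rw [zpowers_le]
        exact ⟨y * z, hg, hfy y hy z⟩
    have hfz : orderOf (f z) = p := by
      refine orderOf_eq_prime (by rw [← map_pow, hzp, map_one]) fun hf => hz1 ?_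
      exact h.eq_one_of_mem_commutator_of_mem_zpowers hN ((hker z).1 hf) hz
    have hrel := relIndex_ker (K := G) f
    rw [hmap, Nat.card_zpowers, hfz, Abelianization.ker_of] at hrel
    rw [← relIndex_bot_left, ← relIndex_bot_left G,
      ← relIndex_mul_relIndex ⊥ (_root_.commutator A ⊓ G) G bot_le inf_le_right,
      inf_relIndex_right, hrel]

theorem le_sup_zpowers_of_card_mul_prime [Finite A] (hp : p.Prime) {Z N : Subgroup A}
    (hle : Z ≤ N) (hcard : Nat.card Z * p = Nat.card N) {x : A} (hx : x ∈ N) (hxZ : x ∉ Z) :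
    N ≤ Z ⊔ zpowers x := by
  have hMN : Z ⊔ zpowers x ≤ N := sup_le hle (by rwa [zpowers_le])
  obtain ⟨r, hr⟩ := card_dvd_of_le (le_sup_left : Z ≤ Z ⊔ zpowers x)
  obtain ⟨t, ht⟩ := card_dvd_of_le hMN
  have hpos : 0 < Nat.card Z := Nat.card_pos
  have hrt : r * t = p := by
    rw [hr, ← hcard, mul_assoc] at ht
    exact (Nat.eq_of_mul_eq_mul_left hpos ht).symm
  rcases (Nat.prime_mul_iff.1 (hrt ▸ hp)) with ⟨_, rfl⟩ | ⟨_, rfl⟩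
  · rw [mul_one] at ht
    exact (eq_of_le_of_card_ge hMN ht.le).ge
  · rw [mul_one] at hr
    have := eq_of_le_of_card_ge (le_sup_left : Z ≤ Z ⊔ zpowers x) hr.le
    exact absurd (this ▸ mem_sup_right (mem_zpowers x)) hxZ

theorem pow_mem_of_card_mul {Z N : Subgroup A} [Finite A] (hle : Z ≤ N)
    (hN : ∀ x ∈ N, ∀ y ∈ N, Commute x y)
    (hcard : Nat.card Z * p = Nat.card N) {x : A} (hx : x ∈ N) : x ^ p ∈ Z := by
  have hn : (Z.subgroupOf N).Normal := (normal_subgroupOf_iff hle).2 fun a b ha hb => by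
    rwa [(hN b hb a (hle ha)).eq, mul_inv_cancel_right]
  have hp : (Z.subgroupOf N).index = p := by
    have h₁ := relIndex_mul_relIndex ⊥ Z N bot_le hle
    rw [relIndex_bot_left, relIndex_bot_left, ← hcard] at h₁
    exact Nat.eq_of_mul_eq_mul_left Nat.card_pos h₁
  have := pow_index_mem (Z.subgroupOf N) ⟨x, hx⟩
  rw [hp] at this
  exact this

/-- For odd `p`, if an involution together with `σ` generates `A`, then `A` has a normal
elementary abelian subgroup complementing `⟨σ⟩` that meets `G` in index at most `p`. -/
theorem exists_normal_of_ne_two [Finite A] (h : IsCyclicFactorization p G σ) (hp : p.Prime)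
    (hp2 : p ≠ 2) {n k m : ℕ} (hcardG : Nat.card G = p ^ n) (hσ : orderOf σ = k * p ^ m)
    {τ : A} (hτ : τ ^ 2 = 1) (hgen : zpowers σ ⊔ zpowers τ = ⊤) :
    (∀ c ∈ zpowers (σ ^ k), ∀ g ∈ G, c * g * c⁻¹ ∈ G) ∧
      ∃ T : Subgroup A, T.Normal ∧ IsCyclicFactorization p T σ ∧
        (T = G ∨ (2 ≤ n ∧ Nat.card (T ⊓ G : Subgroup A) = p ^ (n - 1))) := by
  have hN := h.exists_commutator_mul hp hp2 hτ hgen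
  by_cases hne : _root_.commutator A = G
  · have hn : G.Normal := by rw [← hne]; infer_instance
    exact ⟨fun c _ g hg => hn.conj_mem g hg c, G, hn, h, Or.inl rfl⟩
  obtain ⟨y, hy, z, hz, hyz, hz1, hzp, hG, hcard⟩ := h.exists_generator hp hN hne
  have hcN := h.card_commutator hN
  have hab : ∀ x ∈ _root_.commutator A, ∀ y ∈ _root_.commutator A, Commute x y :=
    fun _ hx _ hy => h.commute_of_mem_commutator hx hy
  have hdisj : ∀ x ∈ _root_.commutator A, x ∈ zpowers σ → x = 1 :=
    fun _ hx hxC => h.eq_one_of_mem_commutator_of_mem_zpowers hN hx hxC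
  have hNn : (_root_.commutator A).Normal := inferInstance
  generalize hNdef : _root_.commutator A = N at *
  have hcardN : Nat.card (N ⊓ G : Subgroup A) * p = Nat.card N := by rw [hcard, hcN]
  -- Here `x` commutes with `y` since both lie in `N`, and with `y * z` since both lie in `G`.
  have hcomm : ∀ x ∈ N ⊓ G, Commute z x := by
    intro x hx
    have := (hab y hy x hx.1).inv_left.mul_left (h.commute _ hyz x hx.2)
    rwa [inv_mul_cancel_left] at this
  -- `N ⊓ G` has prime index in `N`; a larger centraliser of `z` would be all of `N`, making `z`
  -- central in `A = N * ⟨σ⟩`.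
  have hmem : ∀ x ∈ N, (x ∈ N ⊓ G ↔ Commute z x) := by
    refine fun x hx => ⟨hcomm x, fun hzx => by_contra fun hxZ => hz1 ?_⟩
    have hle : N ≤ centralizer {z} :=
      (le_sup_zpowers_of_card_mul_prime hp inf_le_left hcardN hx hxZ).trans <| sup_le
        (fun w hw => mem_centralizer_singleton_iff.2 (hcomm w hw).eq.symm)
        (by rw [zpowers_le, mem_centralizer_singleton_iff]; exact hzx.eq.symm)
    refine h.eq_one_of_commute hz fun g _ => ?_
    obtain ⟨w, hw, c, hc, rfl⟩ := hN g
    exact Commute.mul_right (mem_centralizer_singleton_iff.1 (hle hw)).symm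
      (commute_of_mem_zpowers hz hc)
  have hconj : ∀ c ∈ zpowers σ, ∀ x ∈ N ⊓ G, c * x * c⁻¹ ∈ N ⊓ G := by
    intro c hc x hx
    rw [hmem _ (hNn.conj_mem x hx.1 c)]
    have hcz := commute_of_mem_zpowers hc hz
    have := (hcomm x hx).map (MulAut.conj c).toMonoidHom
    simp only [MulEquiv.toMonoidHom_eq_coe, MonoidHom.coe_coe, MulAut.conj_apply] at this
    rwa [hcz.eq, mul_inv_cancel_right] at this
  have hZn : (N ⊓ G).Normal := by
    refine ⟨fun x hx g => ?_⟩
    obtain ⟨w, hw, c, hc, rfl⟩ := hN g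
    have h₁ := hconj c hc x hx
    have e : w * c * x * (w * c)⁻¹ = w * (c * x * c⁻¹) * w⁻¹ := by group
    rw [e, (hab w hw _ h₁.1).eq, mul_inv_cancel_right]
    exact h₁
  have hyZ : y ∉ N ⊓ G := fun hyZ => hz1 (h.eq_one z ((mul_mem_cancel_left (mem_inf.1 hyZ).2).1 hyz) hz)
  have hle := le_sup_zpowers_of_card_mul_prime hp inf_le_left hcardN hy hyZ
  -- `N / (N ⊓ G)` has order `p` and is generated by `y`, so an element of `p`-power order acts
  -- trivially on it.
  have hcy : ∀ c ∈ zpowers σ, ∀ r, c ^ p ^ r = 1 → c * y * c⁻¹ * y⁻¹ ∈ N ⊓ G := by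
    intro c hc r hcr
    have hq := commute_of_conj_mem_zpowers (A := A ⧸ (N ⊓ G)) (x := c) (y := y) (r := r) hp
      ((QuotientGroup.eq_one_iff (y ^ p)).2
        (pow_mem_of_card_mul inf_le_left hab hcardN hy))
      ((QuotientGroup.eq_one_iff (c ^ p ^ r)).2 (by rw [hcr]; exact one_mem _)) (by
        obtain ⟨w, hw, _, ⟨i, rfl⟩, e⟩ :=
          mem_sup_of_normal_left.1 (hle (hNn.conj_mem y hy c))
        refine ⟨i, ?_⟩
        have := congrArg (QuotientGroup.mk (s := N ⊓ G)) e
        rw [QuotientGroup.mk_mul, (QuotientGroup.eq_one_iff w).2 hw, one_mul] at this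
        exact this)
    rw [← QuotientGroup.eq_one_iff]
    change (c : A ⧸ (N ⊓ G)) * y * (c : A ⧸ (N ⊓ G))⁻¹ * (y : A ⧸ (N ⊓ G))⁻¹ = 1
    rw [hq.eq, mul_inv_cancel_right, mul_inv_cancel]
  have hζ := hcy z hz 1 (by rw [pow_one, hzp])
  -- Expand `(y * z) ^ p = 1`: the factor `ζ ^ p.choose 2` vanishes because `p` divides `p.choose 2`
  -- for odd `p`.
  have hyp : y ^ p = 1 := by
    have h₁ := mul_pow_of_mul_eq (n := y) (z := z) (ζ := z * y * z⁻¹ * y⁻¹)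
      (hab _ hζ.1 y hy) (hcomm _ hζ).symm (by group) p
    obtain ⟨d, hd⟩ := hp.dvd_choose_self two_ne_zero
      (lt_of_le_of_ne hp.two_le (Ne.symm hp2))
    rw [h.pow_eq_one _ hyz, hd, pow_mul, h.pow_eq_one _ hζ.2, one_pow, one_mul, hzp,
      mul_one] at h₁
    exact h₁.symm
  refine ⟨fun c hc g hg => ?_, N, hNn, ⟨hab, fun x hx => ?_, hN, hdisj, h.core_eq_bot⟩,
    Or.inr ?_⟩
  · have hcσ : c ∈ zpowers σ := (zpowers_le.2 (pow_mem (mem_zpowers σ) k)) hc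
    have hcp : c ^ p ^ m = 1 := by
      obtain ⟨i, rfl⟩ := hc
      simp only
      rw [← zpow_natCast, ← zpow_mul, mul_comm, zpow_mul, zpow_natCast, ← pow_mul, ← hσ,
        pow_orderOf_eq_one, one_zpow]
    have h₁ : c * (y * z) * c⁻¹ ∈ G := by
      have e : c * (y * z) * c⁻¹ = (c * y * c⁻¹ * y⁻¹) * (y * (c * z * c⁻¹)) := by group
      rw [e, (commute_of_mem_zpowers hcσ hz).eq, mul_inv_cancel_right]
      exact mul_mem (hcy c hcσ m hcp).2 hyz
    obtain ⟨i, hi⟩ := hG g hg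
    have h₂ := hconj c hcσ _ (mem_inf.2 ⟨hi, mul_mem hg (inv_mem (zpow_mem hyz i))⟩)
    have e : c * g * c⁻¹ = (c * (g * ((y * z) ^ i)⁻¹) * c⁻¹) * (c * (y * z) * c⁻¹) ^ i := by
      rw [conj_zpow]; group
    rw [e]
    exact mul_mem h₂.2 (zpow_mem h₁ i)
  · obtain ⟨w, hw, _, ⟨i, rfl⟩, rfl⟩ := mem_sup_of_normal_left.1 (hle hx)
    simp only
    rw [(hab w hw.1 _ (zpow_mem hy i)).mul_pow, h.pow_eq_one w hw.2, one_mul, ← zpow_natCast,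
      ← zpow_mul, mul_comm, zpow_mul, zpow_natCast, hyp, one_zpow]
  · rw [hcardG] at hcard
    rcases n with _ | _ | n
    · exact absurd (Nat.eq_one_of_mul_eq_one_left hcard) hp.one_lt.ne'
    -- For `n = 1` the group `N ⊓ G` is trivial, so `y` and `z` commute, which puts `y` in `N ⊓ G`.
    · refine absurd ((hmem y hy).2 ?_) hyZ
      have h₁ : Nat.card (N ⊓ G : Subgroup A) = 1 :=
        Nat.eq_of_mul_eq_mul_right hp.pos (by rw [hcard]; ring)
      rw [card_eq_one.1 h₁, mem_bot, mul_inv_eq_one, mul_inv_eq_iff_eq_mul] at hζ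
      exact hζ
    · refine ⟨by omega, Nat.eq_of_mul_eq_mul_right hp.pos ?_⟩
      rw [hcard]
      rfl

end IsCyclicFactorization

end OddPrime

/-! ### Elementary abelian groups and affine actions -/

theorem nonempty_linearEquiv_of_card {p n : ℕ} [hp : Fact p.Prime] {V : Type*} [AddCommGroup V]
    [Finite V] [Module (ZMod p) V] (hcard : Nat.card V = p ^ n) :
    Nonempty (V ≃ₗ[ZMod p] (Fin n → ZMod p)) := by
  have hfin : Module.finrank (ZMod p) V = n := by
    have h := FiniteField.pow_finrank_eq_natCard p V
    rw [hcard] at h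
    exact Nat.pow_right_injective hp.out.two_le h
  exact ⟨(Module.finBasisOfFinrankEq (ZMod p) V hfin).equivFun⟩

theorem nonempty_mulEquiv_elemAb {T : Type*} [Group T] [Finite T] {p n : ℕ} (hp : p.Prime)
    (hcomm : ∀ x y : T, x * y = y * x) (hpow : ∀ x : T, x ^ p = 1) (hcard : Nat.card T = p ^ n) :
    Nonempty (T ≃* ElemAb p n) := by
  have : Fact p.Prime := ⟨hp⟩
  let _ : CommGroup T := { (inferInstance : Group T) with mul_comm := hcomm }
  let _ : Module (ZMod p) (Additive T) := AddCommGroup.zmodModule fun x => hpow x.toMul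
  obtain ⟨f⟩ := nonempty_linearEquiv_of_card (p := p) (n := n) (V := Additive T)
    ((Nat.card_congr Additive.toMul).trans hcard)
  exact ⟨{ toEquiv := Additive.ofMul.trans (f.toEquiv.trans Multiplicative.ofAdd)
           map_mul' := fun x y => f.map_add (Additive.ofMul x) (Additive.ofMul y) }⟩

section Affine

variable {A Ω : Type*} [Group A] [MulAction A Ω]

/-- A group acting faithfully, with a normal subgroup `T ≅ ℤ_p ^ n` regular on the points, embeds
in `AGL(n, p)` with `T` mapped onto the translations. -/
theorem exists_affine_embedding [FaithfulSMul A Ω] {p n : ℕ} (T : Subgroup A) [T.Normal]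
    (hreg : IsRegularOn Ω T) (v : Ω) (θ : T ≃* ElemAb p n) :
    ∃ (φ : A →* AGL n p) (e : Ω ≃ (Fin n → ZMod p)), Function.Injective φ ∧ e v = 0 ∧
      (∀ (a : A) (x : Ω), φ a (e x) = e (a • x)) ∧ T.map φ = AGL.translations n p := by
  let o : T ≃ Ω := Equiv.ofBijective (fun t => t • v) ⟨fun t t' h =>
    (hreg v (t • v)).unique rfl h.symm, fun u => (hreg v u).exists⟩
  let e : Ω ≃ (Fin n → ZMod p) := o.symm.trans (θ.toEquiv.trans Multiplicative.toAdd)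
  have heo : ∀ t : T, e (t • v) = (θ t).toAdd := fun t => by
    change (θ (o.symm (o t))).toAdd = _
    rw [o.symm_apply_apply]
  have hes : ∀ (t : T) (x : Ω), e (t • x) = (θ t).toAdd + e x := fun t x => by
    obtain ⟨s, rfl⟩ := o.surjective x
    change e (t • s • v) = _ + e (s • v)
    rw [← mul_smul, heo, heo, map_mul, toAdd_mul]
  let L : A → ((Fin n → ZMod p) ≃+ (Fin n → ZMod p)) := fun a =>
    MulEquiv.toAdditive ((θ.symm.trans (MulAut.conjNormal a)).trans θ)
  have hL : ∀ (a : A) (w : Fin n → ZMod p),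
      L a w = (θ (MulAut.conjNormal a (θ.symm (Multiplicative.ofAdd w)))).toAdd :=
    fun a w => rfl
  -- The identity `a • t • x = (a * t * a⁻¹) • a • x` makes the action of `a` affine with
  -- conjugation by `a` as linear part.
  let ψ : A → AGL n p := fun a =>
    { toEquiv := e.symm.trans ((MulAction.toPerm a).trans e)
      linear := { L a with map_smul' := fun c w => ZMod.map_smul (L a).toAddMonoidHom c w }
      map_vadd' := fun q w => by
        obtain ⟨x, rfl⟩ := e.surjective q
        obtain ⟨t, ht⟩ := θ.surjective (Multiplicative.ofAdd w)
        have hw : w = (θ t).toAdd := by rw [ht]; rfl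
        change e (a • e.symm (w + e x)) = L a w + e (a • e.symm (e x))
        rw [e.symm_apply_apply, hL, hw, ofAdd_toAdd, θ.symm_apply_apply, ← hes, ← hes,
          e.symm_apply_apply]
        congr 1
        change a • (t : A) • x = ((MulAut.conjNormal a t : T) : A) • a • x
        rw [MulAut.conjNormal_apply, smul_smul, smul_smul, inv_mul_cancel_right] }
  have hψ : ∀ (a : A) (x : Ω), ψ a (e x) = e (a • x) := fun a x => by
    change e (a • e.symm (e x)) = _
    rw [e.symm_apply_apply]
  let φ : A →* AGL n p :=
    { toFun := ψ
      map_one' := by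
        refine AffineEquiv.ext fun q => ?_
        obtain ⟨x, rfl⟩ := e.surjective q
        rw [hψ, one_smul]
        rfl
      map_mul' := fun a b => by
        refine AffineEquiv.ext fun q => ?_
        obtain ⟨x, rfl⟩ := e.surjective q
        rw [hψ, mul_smul, ← hψ, ← hψ]
        rfl }
  have hφ : ∀ (a : A) (x : Ω), φ a (e x) = e (a • x) := hψ
  have htrans : ∀ t : T, φ t = AffineEquiv.constVAddHom (ZMod p) (Fin n → ZMod p) (θ t) := by
    intro t
    refine AffineEquiv.ext fun q => ?_
    obtain ⟨x, rfl⟩ := e.surjective q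
    rw [hφ]
    exact hes t x
  refine ⟨φ, e, fun a b hab => ?_, ?_, hφ, ?_⟩
  · refine FaithfulSMul.eq_of_smul_eq_smul (α := Ω) fun x => e.injective ?_
    rw [← hφ, hab, hφ]
  · have := heo 1
    rwa [one_smul, map_one] at this
  · ext f
    constructor
    · rintro ⟨t, ht, rfl⟩
      exact ⟨θ ⟨t, ht⟩, (htrans ⟨t, ht⟩).symm⟩
    · rintro ⟨w, rfl⟩
      refine ⟨θ.symm w, (θ.symm w).2, ?_⟩
      rw [htrans, θ.apply_symm_apply]

end Affine

namespace IsCyclicFactorization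

open Subgroup

variable {A : Type*} [Group A] {p : ℕ} {G : Subgroup A} {σ : A}

theorem isInternalSemidirect_sup (h : IsCyclicFactorization p G σ) {k : ℕ}
    (hk : ∀ c ∈ zpowers (σ ^ k), ∀ g ∈ G, c * g * c⁻¹ ∈ G) :
    IsInternalSemidirect G (zpowers (σ ^ k)) (G ⊔ zpowers (σ ^ k)) := by
  refine ⟨rfl, ?_, (normal_subgroupOf_iff le_sup_left).2 ?_⟩
  · rw [← disjoint_iff, disjoint_def]
    exact fun hx hy => h.eq_one _ hx (zpowers_le.2 (pow_mem (mem_zpowers σ) k) hy)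
  · have hle : G ⊔ zpowers (σ ^ k) ≤ normalizer (G : Set A) := by
      refine sup_le le_normalizer fun c hc => mem_normalizer_iff.2 fun g => ⟨hk c hc g, fun hg => ?_⟩
      simpa [mul_assoc] using hk _ (inv_mem hc) _ hg
    exact fun g x hg hx => (mem_normalizer_iff.1 (hle hx) g).1 hg

theorem isInternalSemidirect_of_normal (h : IsCyclicFactorization p G σ) [hn : G.Normal] :
    IsInternalSemidirect G (zpowers σ) ⊤ := by
  refine ⟨?_, ?_, inferInstance⟩
  · rw [eq_top_iff]
    intro x _
    obtain ⟨g, hg, c, hc, rfl⟩ := h.exists_mul x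
    exact mul_mem (mem_sup_left hg) (mem_sup_right hc)
  · rw [← disjoint_iff, disjoint_def]
    exact fun hx hy => h.eq_one _ hx hy

theorem isRegularOn {Ω : Type*} [MulAction A Ω] [MulAction.IsPretransitive A Ω]
    (h : IsCyclicFactorization p G σ) {v : Ω} (hv : MulAction.stabilizer A v = zpowers σ) :
    IsRegularOn Ω G := by
  have hex : ∀ u : Ω, ∃ t ∈ G, t • v = u := by
    intro u
    obtain ⟨a, rfl⟩ := MulAction.exists_smul_eq A v u
    obtain ⟨t, ht, c, hc, rfl⟩ := h.exists_mul a
    rw [← hv, MulAction.mem_stabilizer_iff] at hc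
    exact ⟨t, ht, by rw [mul_smul, hc]⟩
  intro u w
  obtain ⟨s, hs, rfl⟩ := hex u
  obtain ⟨t, ht, rfl⟩ := hex w
  refine ⟨⟨t * s⁻¹, mul_mem ht (inv_mem hs)⟩, ?_, ?_⟩
  · change (t * s⁻¹) • s • v = t • v
    rw [smul_smul, inv_mul_cancel_right]
  · rintro ⟨r, hr⟩ he
    change r • s • v = t • v at he
    refine Subtype.ext (eq_mul_inv_of_mul_eq (inv_mul_eq_one.1 (h.eq_one _ ?_ ?_)).symm)
    · exact mul_mem (inv_mem ht) (mul_mem hr hs)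
    · rw [← hv, MulAction.mem_stabilizer_iff, mul_smul, mul_smul, he, inv_smul_smul]

end IsCyclicFactorization

/-! ### Application to regular Cayley maps -/

namespace CayleyMap

variable {G : Type*} [Group G] (M : CayleyMap G)

theorem aut_smul_def (a : M.aut) (x : G) : a • x = (a : M.graph ≃g M.graph) x := rfl

theorem leftRegular_smul (g x : G) : M.leftRegular g • x = g * x := rfl

instance : FaithfulSMul M.aut G :=
  ⟨fun h => Subtype.ext (RelIso.ext h)⟩

instance : MulAction.IsPretransitive M.aut G :=
  ⟨fun x y => ⟨M.leftRegular (y * x⁻¹), by rw [leftRegular_smul, inv_mul_cancel_right]⟩⟩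

instance [Finite G] : Finite M.aut :=
  Finite.of_injective (fun a => ((a : M.graph ≃g M.graph) : G → G))
    fun _ _ h => Subtype.ext (RelIso.ext (congrFun h))

theorem leftRegular_injective : Function.Injective M.leftRegular := fun a b h => by
  have := congrArg (fun c : M.aut => c • (1 : G)) h
  simpa [leftRegular_smul] using this

theorem isCyclicFactorization {p : ℕ} (hcomm : ∀ x y : G, x * y = y * x)
    (hpow : ∀ x : G, x ^ p = 1) {v : G} {σ : M.aut}
    (hσ : MulAction.stabilizer M.aut v = Subgroup.zpowers σ) :
    IsCyclicFactorization p M.leftRegular.range σ where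
  commute := by
    rintro _ ⟨x, rfl⟩ _ ⟨y, rfl⟩
    exact Commute.map (hcomm x y) M.leftRegular
  pow_eq_one := by
    rintro _ ⟨x, rfl⟩
    rw [← map_pow, hpow, map_one]
  exists_mul a := by
    refine ⟨M.leftRegular (a • v * v⁻¹), ⟨_, rfl⟩, _, ?_, mul_inv_cancel_left _ a⟩
    rw [← hσ, MulAction.mem_stabilizer_iff, mul_smul, ← map_inv, leftRegular_smul]
    group
  eq_one := by
    rintro _ ⟨x, rfl⟩ hx
    rw [← hσ, MulAction.mem_stabilizer_iff, leftRegular_smul, mul_eq_right] at hx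
    rw [hx, map_one]
  core_eq_bot R hR hle := by
    -- A normal subgroup fixing `v` fixes every vertex by transitivity, and the action is faithful.
    refine (Subgroup.eq_bot_iff_forall R).2 fun r hr => ?_
    refine FaithfulSMul.eq_of_smul_eq_smul (α := G) fun x => ?_
    obtain ⟨a, rfl⟩ := MulAction.exists_smul_eq M.aut v x
    have h₁ := hle (hR.conj_mem r hr a⁻¹)
    rw [← hσ, MulAction.mem_stabilizer_iff, inv_inv, mul_smul, mul_smul, inv_smul_eq_iff] at h₁
    rw [h₁, one_smul]

/-- In a regular map the stabiliser of a vertex and an involution reversing an arc generate the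
automorphism group. -/
theorem exists_reverser (hM : M.IsRegular) {v : G} {σ : M.aut}
    (hσ : MulAction.stabilizer M.aut v = Subgroup.zpowers σ) :
    ∃ τ : M.aut, τ ^ 2 = 1 ∧ Subgroup.zpowers σ ⊔ Subgroup.zpowers τ = ⊤ := by
  -- Without arcs `G` is trivial and there is nothing to reverse; `τ = 1` serves.
  rcases M.S.eq_empty_or_nonempty with hS | ⟨s, hs⟩
  · have hcl := M.closure_eq_top
    rw [hS, Subgroup.closure_empty] at hcl
    have hone : ∀ x : G, x = 1 := fun x => Subgroup.mem_bot.1 (hcl ▸ Subgroup.mem_top x)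
    refine ⟨1, one_pow 2, eq_top_iff.2 fun a _ => Subgroup.mem_sup_left ?_⟩
    rw [← hσ, MulAction.mem_stabilizer_iff]
    rw [hone v, hone (a • 1)]
  · let d : M.graph.Dart := ⟨(v, v * s), by simpa [graph_adj] using hs⟩
    obtain ⟨τ, hτ, -⟩ := hM d d.symm
    have hτ₁ : τ • v = v * s := congrArg (fun d : M.graph.Dart => d.fst) hτ
    have hτ₂ : τ • (v * s) = v := congrArg (fun d : M.graph.Dart => d.snd) hτ
    refine ⟨τ, (hM d d).unique ?_ (y₂ := 1) rfl, ?_⟩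
    · have h₁ : τ ^ 2 • v = v := by rw [pow_two, mul_smul, hτ₁, hτ₂]
      have h₂ : τ ^ 2 • (v * s) = v * s := by rw [pow_two, mul_smul, hτ₂, hτ₁]
      exact SimpleGraph.Dart.ext _ _ (Prod.ext h₁ h₂)
    · set B := Subgroup.zpowers σ ⊔ Subgroup.zpowers τ
      have hσB : Subgroup.zpowers σ ≤ B := le_sup_left
      have hτB : τ ∈ B := Subgroup.mem_sup_right (Subgroup.mem_zpowers τ)
      -- The stabiliser of `v` is transitive on the arcs at `v` and `τ` takes `v` to a neighbour, so
      -- the orbit of `v` under `B` is closed under adjacency.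
      have hstep : ∀ x : G, ∀ t ∈ M.S, (∃ b ∈ B, b • v = x) → ∃ b ∈ B, b • v = x * t := by
        rintro x t ht ⟨b, hb, rfl⟩
        have hadj : M.graph.Adj v (b⁻¹ • (b • v * t)) := by
          have h₁ : M.graph.Adj (b • v) (b • v * t) := by simpa [graph_adj] using ht
          have h₂ := ((b⁻¹ : M.aut) : M.graph ≃g M.graph).map_adj_iff.2 h₁
          rwa [← aut_smul_def, ← aut_smul_def, inv_smul_smul] at h₂
        obtain ⟨φ, hφ, -⟩ := hM d ⟨(v, b⁻¹ • (b • v * t)), hadj⟩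
        have hφ₁ : φ • v = v := congrArg (fun d : M.graph.Dart => d.fst) hφ
        have hφ₂ : φ • (v * s) = b⁻¹ • (b • v * t) :=
          congrArg (fun d : M.graph.Dart => d.snd) hφ
        have hφB : φ ∈ B := hσB (by rwa [← hσ, MulAction.mem_stabilizer_iff])
        refine ⟨b * φ * τ, mul_mem (mul_mem hb hφB) hτB, ?_⟩
        rw [mul_smul, mul_smul, hτ₁, hφ₂, smul_inv_smul]
      have horbit : ∀ g : G, ∃ b ∈ B, b • v = v * g := by
        intro g
        have hg : g ∈ Subgroup.closure M.S := M.closure_eq_top ▸ Subgroup.mem_top g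
        induction hg using Subgroup.closure_induction_right with
        | one => exact ⟨1, one_mem B, by rw [one_smul, mul_one]⟩
        | mul_right x _ y hy ih => rw [← mul_assoc]; exact hstep _ y hy ih
        | mul_inv_cancel x _ y hy ih =>
          rw [← mul_assoc]; exact hstep _ _ (M.inv_mem y hy) ih
      refine eq_top_iff.2 fun a _ => ?_
      obtain ⟨b, hb, he⟩ := horbit (v⁻¹ * a • v)
      rw [mul_inv_cancel_left] at he
      have h₁ : b⁻¹ * a ∈ B := hσB (by
        rw [← hσ, MulAction.mem_stabilizer_iff, mul_smul, ← he, inv_smul_smul])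
      simpa using mul_mem hb h₁

end CayleyMap

theorem theorem1p1 {G : Type*} [Group G] (p n : ℕ) (hp : p.Prime)
    (hG : Nonempty (G ≃* ElemAb p n))
    (M : CayleyMap G) (hM : M.IsRegular)
    (v : G) (σ : M.aut) (hσ : MulAction.stabilizer M.aut v = Subgroup.zpowers σ)
    (k m : ℕ) (hk : ¬ p ∣ k) (hord : Nat.card (MulAction.stabilizer M.aut v) = k * p ^ m) :
    (IsInternalSemidirect M.leftRegular.range (Subgroup.zpowers (σ ^ k))
        (M.leftRegular.range ⊔ Subgroup.zpowers (σ ^ k)) ∧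
      IsInternalSemidirect (M.leftRegular.range ⊔ Subgroup.zpowers (σ ^ k))
        (Subgroup.zpowers (σ ^ (p ^ m))) ⊤) ∧
    ∃ T : Subgroup M.aut,
      T.Normal ∧ IsRegularOn G T ∧ Nonempty (T ≃* ElemAb p n) ∧
      (T = M.leftRegular.range ∨
        (2 ≤ n ∧ Nonempty (↥(T ⊓ M.leftRegular.range) ≃* ElemAb p (n - 1)))) ∧
      IsInternalSemidirect T (Subgroup.zpowers σ) ⊤ ∧
      ∃ (φ : M.aut →* AGL n p) (e : G ≃ (Fin n → ZMod p)),
        Function.Injective φ ∧ e v = 0 ∧ (∀ (a : M.aut) (x : G), φ a (e x) = e (a • x)) ∧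
        T.map φ = AGL.translations n p := by
  have : Fact p.Prime := ⟨hp⟩
  obtain ⟨θ⟩ := hG
  have hcomm : ∀ x y : G, x * y = y * x := fun x y => θ.injective (by
    rw [map_mul, map_mul, mul_comm])
  have hpow : ∀ x : G, x ^ p = 1 := fun x => θ.injective (by
    rw [map_pow, map_one]
    refine Multiplicative.toAdd.injective (funext fun i => ?_)
    simp)
  have hfin : Finite G := Finite.of_equiv _ θ.symm.toEquiv
  have hcard : Nat.card M.leftRegular.range = p ^ n := by
    rw [← Nat.card_congr (MonoidHom.ofInjective M.leftRegular_injective).toEquiv,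
      Nat.card_congr θ.toEquiv, Nat.card_congr Multiplicative.toAdd]
    simp
  have hσk : orderOf σ = k * p ^ m := by rw [← hord, hσ, Nat.card_zpowers]
  have h := M.isCyclicFactorization (p := p) hcomm hpow hσ
  obtain ⟨hconj, T, hTn, hT, hTG⟩ :
      (∀ c ∈ Subgroup.zpowers (σ ^ k), ∀ g ∈ M.leftRegular.range,
        c * g * c⁻¹ ∈ M.leftRegular.range) ∧
      ∃ T : Subgroup M.aut, T.Normal ∧ IsCyclicFactorization p T σ ∧
        (T = M.leftRegular.range ∨
          (2 ≤ n ∧ Nat.card (T ⊓ M.leftRegular.range : Subgroup M.aut) = p ^ (n - 1))) := by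
    rcases eq_or_ne p 2 with rfl | hp2
    · have hn := h.normal_of_two hcard hk hσk
      exact ⟨fun c _ g hg => hn.conj_mem g hg c, _, hn, h, Or.inl rfl⟩
    · obtain ⟨τ, hτ, hgen⟩ := M.exists_reverser hM hσ
      exact h.exists_normal_of_ne_two hp hp2 hcard hσk hτ hgen
  have hcardT : Nat.card T = p ^ n := by
    rw [← hcard, ← hT.isComplement.index_eq_card, h.isComplement.index_eq_card]
  have hreg : IsRegularOn G T := hT.isRegularOn hσ
  obtain ⟨θT⟩ := nonempty_mulEquiv_elemAb (T := T) hp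
    (fun x y => Subtype.ext (hT.commute x x.2 y y.2).eq)
    (fun x => Subtype.ext (hT.pow_eq_one x x.2)) hcardT
  refine ⟨⟨h.isInternalSemidirect_sup hconj, h.isInternalSemidirect_top hp hcard hk hσk⟩,
    T, hTn, hreg, ⟨θT⟩, hTG.imp_right fun h' => ⟨h'.1, ?_⟩,
    hT.isInternalSemidirect_of_normal, exists_affine_embedding T hreg v θT⟩
  exact nonempty_mulEquiv_elemAb hp
    (fun x y => Subtype.ext (hT.commute x x.2.1 y y.2.1).eq)
    (fun x => Subtype.ext (hT.pow_eq_one x x.2.1)) h'.2
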